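/- Consider the Evans causal structure: observable variables $A,B,C\in\{0,1\}$ and two independent latent sources $\Lambda$, $M$, with arrows $\Lambda\to A$, $\Lambda\to B$, $M\to B$, $M\to C$, $B\to A$, $B\to C$. A *generalized probabilistic theory* (GPT) is taken here in operational form: a symmetric monoidal category of systems and processes, in which certain finite families of processes with a common input and output system are singled out as *tests* (the possible outcomes of one run of a device), such that (i) tests are closed under relabelling of outcomes, sequential composition and parallel composition, and identities, regroupings, swaps, and the addition or removal of the trivial system $I$ are one-outcome tests; (ii) every system can be discarded, i.e. admits a one-outcome test to $I$; (iii) every process $I\to I$ has a real number, its probability, such that the outcomes of a test $I\to I$ have nonnegative probabilities summing to $1$, and the composite of two processes $I\to I$ has the product of their probabilities; (iv) (causality) the probability of an outcome of a preparation, i.e. of a test from $I$ to a system, summed over the outcomes of a subsequent measurement, i.e. of a test from that system to $I$, does not depend on the choice of that measurement. A behavior $p(a,b,c)$ is *compatible with the Evans structure under GPT sources* if in some GPT there are systems $\Lambda_A,\Lambda_B,M_B,M_C$, one-outcome preparations $\omega$ of $\Lambda_A\otimes\Lambda_B$ and $\mu$ of $M_B\otimes M_C$, a measurement $\{e^b\}_b$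 on $\Lambda_B\otimes M_B$, and, for each $b\in\{0,1\}$, measurements $\{e^a_b\}_a$ on $\Lambda_A$ and $\{e^c_b\}_c$ on $M_C$, such that, for all $a,b,c$, $$p(a,b,c)=(e^a_b\otimes e^b\otimes e^c_b)\circ(\omega\otimes\mu),$$ the right-hand side denoting the probability of this closed circuit. 1. Every behavior $p$ that is compatible with the Evans structure under GPT sources satisfies $$W(p):=p(0,0,0)^2+p(0,0,1)\,p(0,0,0)+p(0,0,1)^2+4\,p(1,0,1)\,p(0,0,0)+p(1,0,0)^2+p(1,0,1)\,p(1,0,0)+p(1,0,1)^2\le 1 .$$ 2. The distribution $p_*$ with $p_*(0,0,0)=p_*(1,0,1)=\tfrac12$ has $W(p_*)=\tfrac32$; hence it violates the inequality and is not compatible with the Evans structure under GPT sources. 3. Let $p_W(a,b,c)=\tfrac18$ be white noise. For $v\in[0,1]$, the mixture $v\,p_*+(1-v)\,p_W$ violates the inequality, i.e. $W(v\,p_*+(1-v)\,p_W)>1$, if and only if $v>v_{\rm crit}$, where $v_{\rm crit}=\frac{6\sqrt{21}-9}{25}$, and $|v_{\rm crit}-0.7398|<5\cdot10^{-5}$.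 -/

import Mathlib

open CategoryTheory MonoidalCategory

universe v u

/-- A generalized probabilistic theory, in operational form (a causal operational probabilistic
theory).  Systems are the objects and physical processes ("events") are among the morphisms of a
symmetric monoidal category `C`: `≫` is sequential composition, `⊗` is parallel composition, and
`𝟙_ C` is the trivial system.  Events `𝟙_ C ⟶ S` are (unnormalized) states of `S` and events
`S ⟶ 𝟙_ C` are effects on `S`.  The theory says which finite families of events are tests (the
possible outcomes of one run of a device) and gives every closed circuit a probability.
Nothing else is required: no local tomography, no finite dimension, no restriction on the
composite of two systems beyond its containing the product states and product effects. -/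
structure GPT (C : Type u) [Category.{v} C] [MonoidalCategory C] [SymmetricCategory C] where
  /-- `IsTest t`: the family `t`, indexed by a finite set of outcomes, is a test from `S` to `T`. -/
  IsTest : ∀ {X : Type} [Finite X] {S T : C}, (X → (S ⟶ T)) → Prop
  /-- The outcomes of a test may be relabelled. -/
  relabel : ∀ {X Y : Type} [Finite X] [Finite Y] {S T : C} {t : X → (S ⟶ T)} (e : Y ≃ X),
    IsTest t → IsTest fun y => t (e y)
  /-- Tests may be composed in sequence. -/
  comp : ∀ {X Y : Type} [Finite X] [Finite Y] {S T U : C} {s : X → (S ⟶ T)} {t : Y → (T ⟶ U)},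
    IsTest s → IsTest t → IsTest fun z : X × Y => s z.1 ≫ t z.2
  /-- Tests may be composed in parallel. -/
  tensor : ∀ {X Y : Type} [Finite X] [Finite Y] {S T S' T' : C}
    {s : X → (S ⟶ T)} {t : Y → (S' ⟶ T')},
    IsTest s → IsTest t → IsTest fun z : X × Y => s z.1 ⊗ₘ t z.2
  /-- Doing nothing, regrouping systems, adding or dropping the trivial system, and swapping two
  systems are deterministic (one-outcome) tests. -/
  id : ∀ S : C, IsTest fun _ : Unit => 𝟙 S
  associator : ∀ S T U : C, IsTest fun _ : Unit => (α_ S T U).hom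
  associator_inv : ∀ S T U : C, IsTest fun _ : Unit => (α_ S T U).inv
  leftUnitor : ∀ S : C, IsTest fun _ : Unit => (λ_ S).hom
  leftUnitor_inv : ∀ S : C, IsTest fun _ : Unit => (λ_ S).inv
  rightUnitor : ∀ S : C, IsTest fun _ : Unit => (ρ_ S).hom
  rightUnitor_inv : ∀ S : C, IsTest fun _ : Unit => (ρ_ S).inv
  braiding : ∀ S T : C, IsTest fun _ : Unit => (β_ S T).hom
  /-- Every system can be discarded. -/
  exists_discard : ∀ S : C, ∃ d : S ⟶ 𝟙_ C, IsTest fun _ : Unit => d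
  /-- The probability of a closed circuit. -/
  prob : (𝟙_ C ⟶ 𝟙_ C) → ℝ
  /-- The outcomes of a closed test have nonnegative probabilities ... -/
  prob_nonneg : ∀ {X : Type} [Finite X] {t : X → (𝟙_ C ⟶ 𝟙_ C)}, IsTest t → ∀ x, 0 ≤ prob (t x)
  /-- ... that sum to one. -/
  sum_prob : ∀ {X : Type} [Fintype X] {t : X → (𝟙_ C ⟶ 𝟙_ C)}, IsTest t → ∑ x, prob (t x) = 1
  /-- Disconnected closed circuits are statistically independent. -/
  prob_comp : ∀ s t : 𝟙_ C ⟶ 𝟙_ C, prob (s ≫ t) = prob s * prob t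
  /-- Causality (no signalling from the future): the probability of an outcome of a preparation
  does not depend on which measurement is carried out later. -/
  causality : ∀ {X Y Z : Type} [Finite X] [Fintype Y] [Fintype Z] {S : C}
    {r : X → (𝟙_ C ⟶ S)} {s : Y → (S ⟶ 𝟙_ C)} {t : Z → (S ⟶ 𝟙_ C)},
    IsTest r → IsTest s → IsTest t →
      ∀ x, ∑ y, prob (r x ≫ s y) = ∑ z, prob (r x ≫ t z)

/-- The closed circuit of the Evans causal structure.  The source `Λ` emits the state `ω` of a
system `LA` sent to `A` and a system `LB` sent to `B`; the source `M`, independent of `Λ`, emits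
the state `μ` of a system `MB` sent to `B` and a system `MC` sent to `C`.  The effects `eA`, `eB`,
`eC` are applied to `LA`, to `LB ⊗ MB` and to `MC`. -/
def evansCircuit {C : Type u} [Category.{v} C] [MonoidalCategory C] {LA LB MB MC : C}
    (ω : 𝟙_ C ⟶ LA ⊗ LB) (μ : 𝟙_ C ⟶ MB ⊗ MC)
    (eA : LA ⟶ 𝟙_ C) (eB : LB ⊗ MB ⟶ 𝟙_ C) (eC : MC ⟶ 𝟙_ C) : 𝟙_ C ⟶ 𝟙_ C :=
  (λ_ (𝟙_ C)).inv ≫ (ω ⊗ₘ μ) ≫ (α_ LA LB (MB ⊗ MC)).hom ≫ (𝟙 LA ⊗ₘ (α_ LB MB MC).inv) ≫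
    (eA ⊗ₘ (eB ⊗ₘ eC)) ≫ (λ_ (𝟙_ C ⊗ 𝟙_ C)).hom ≫ (λ_ (𝟙_ C)).hom

/-- `G.IsEvansBehavior p`: the theory `G` can produce the behavior `p(a, b, c)` in the Evans causal
structure `A ← Λ → B ← M → C`, `B → A`, `B → C`.  The sources emit deterministically prepared
states, `B` carries out a measurement, and `A` and `C` carry out measurements
that they choose according to the outcome `b`. -/
def GPT.IsEvansBehavior {C : Type u} [Category.{v} C] [MonoidalCategory C] [SymmetricCategory C]
    (G : GPT C) {X Y Z : Type} [Finite X] [Finite Y] [Finite Z] (p : X → Y → Z → ℝ) : Prop :=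
  ∃ (LA LB MB MC : C) (ω : 𝟙_ C ⟶ LA ⊗ LB) (μ : 𝟙_ C ⟶ MB ⊗ MC)
    (eA : Y → X → (LA ⟶ 𝟙_ C)) (eB : Y → (LB ⊗ MB ⟶ 𝟙_ C)) (eC : Y → Z → (MC ⟶ 𝟙_ C)),
    G.IsTest (fun _ : Unit => ω) ∧ G.IsTest (fun _ : Unit => μ) ∧
    (∀ b, G.IsTest (eA b)) ∧ G.IsTest eB ∧ (∀ b, G.IsTest (eC b)) ∧
    ∀ a b c, p a b c = G.prob (evansCircuit ω μ (eA b a) (eB b) (eC b c))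

/-- The binary behaviors `p(a, b, c)` that are compatible with the Evans causal structure for some
generalized probabilistic theory. -/
def evansGPTBehaviors : Set (Fin 2 → Fin 2 → Fin 2 → ℝ) :=
  {p | ∃ (C : Type u) (_ : Category.{v} C) (_ : MonoidalCategory C) (_ : SymmetricCategory C)
    (G : GPT C), G.IsEvansBehavior p}

/-- The quadratic witness. -/
def evansWitness (p : Fin 2 → Fin 2 → Fin 2 → ℝ) : ℝ :=
  p 0 0 0 ^ 2 + p 0 0 1 * p 0 0 0 + p 0 0 1 ^ 2 + 4 * (p 1 0 1 * p 0 0 0) +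
    p 1 0 0 ^ 2 + p 1 0 1 * p 1 0 0 + p 1 0 1 ^ 2

/-- The distribution with `p(0,0,0) = p(1,0,1) = 1/2`. -/
noncomputable def pUnfeasible (a b c : Fin 2) : ℝ :=
  if (a = 0 ∧ b = 0 ∧ c = 0) ∨ (a = 1 ∧ b = 0 ∧ c = 1) then 1 / 2 else 0

/-- White noise: all `8` outcomes are equally likely. -/
noncomputable def pWhite (_a _b _c : Fin 2) : ℝ := 1 / 8

/-- The mixture `v p_unfeasible + (1 - v) p_W`. -/
noncomputable def pMixed (v : ℝ) (a b c : Fin 2) : ℝ :=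
  v * pUnfeasible a b c + (1 - v) * pWhite a b c

/-! Fix the outcome `b` and keep the settings of `A` and `C` at this value while `B`'s outcome `b'`
varies. The effects of `A` and `C` herald a preparation of `LB ⊗ MB`, so by causality the sum over
`b'` is unchanged when `B` discards both systems instead. The circuit then splits into one factor
per source, whence `p a b c ≤ α a * γ c` with `α`, `γ` probability distributions
(`IsEvansBehavior.exists_le_mul`). The witness involves only `b = 0` and has nonnegative
coefficients, so it remains to bound it on product distributions (`evansWitness_le_one_of_le_mul`).
-/

namespace GPT

variable {C : Type u} [Category.{v} C] [MonoidalCategory C] [SymmetricCategory C] (G : GPT C)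

/-- A deterministic process followed by a test is a test. -/
theorem isTest_unit_comp {Y : Type} [Finite Y] {S T U : C} {s : S ⟶ T} {t : Y → (T ⟶ U)}
    (hs : G.IsTest fun _ : Unit => s) (ht : G.IsTest t) : G.IsTest fun y => s ≫ t y :=
  G.relabel (Equiv.punitProd Y).symm (G.comp hs ht)

/-- A test followed by a deterministic process is a test. -/
theorem isTest_comp_unit {X : Type} [Finite X] {S T U : C} {s : X → (S ⟶ T)} {t : T ⟶ U}
    (hs : G.IsTest s) (ht : G.IsTest fun _ : Unit => t) : G.IsTest fun x => s x ≫ t :=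
  G.relabel (Equiv.prodPUnit X).symm (G.comp hs ht)

/-- A deterministic process in parallel with a test is a test. -/
theorem isTest_unit_tensor {Y : Type} [Finite Y] {S T S' T' : C} {s : S ⟶ T}
    {t : Y → (S' ⟶ T')} (hs : G.IsTest fun _ : Unit => s) (ht : G.IsTest t) :
    G.IsTest fun y => s ⊗ₘ t y :=
  G.relabel (Equiv.punitProd Y).symm (G.tensor hs ht)

/-- A test in parallel with a deterministic process is a test. -/
theorem isTest_tensor_unit {X : Type} [Finite X] {S T S' T' : C} {s : X → (S ⟶ T)}
    {t : S' ⟶ T'} (hs : G.IsTest s) (ht : G.IsTest fun _ : Unit => t) :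
    G.IsTest fun x => s x ⊗ₘ t :=
  G.relabel (Equiv.prodPUnit X).symm (G.tensor hs ht)

end GPT

section Circuits

variable {C : Type u} [Category.{v} C] [MonoidalCategory C] {LA LB MB MC : C}

/-- The state of `LB ⊗ MB` that the effects `eA` and `eC` herald in the Evans circuit. -/
def evansPreparation (ω : 𝟙_ C ⟶ LA ⊗ LB) (μ : 𝟙_ C ⟶ MB ⊗ MC)
    (eA : LA ⟶ 𝟙_ C) (eC : MC ⟶ 𝟙_ C) : 𝟙_ C ⟶ LB ⊗ MB :=
  (λ_ (𝟙_ C)).inv ≫ (ω ⊗ₘ μ) ≫ (α_ LA LB (MB ⊗ MC)).hom ≫ (𝟙 LA ⊗ₘ (α_ LB MB MC).inv) ≫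
    (eA ⊗ₘ (𝟙 (LB ⊗ MB) ⊗ₘ eC)) ≫ (λ_ ((LB ⊗ MB) ⊗ 𝟙_ C)).hom ≫ (ρ_ (LB ⊗ MB)).hom

/-- By the interchange law `eB` can be delayed until after `eA` and `eC`. This gives the form,
preparation followed by measurement, to which causality applies. -/
theorem evansPreparation_comp (ω : 𝟙_ C ⟶ LA ⊗ LB) (μ : 𝟙_ C ⟶ MB ⊗ MC)
    (eA : LA ⟶ 𝟙_ C) (eB : LB ⊗ MB ⟶ 𝟙_ C) (eC : MC ⟶ 𝟙_ C) :
    evansPreparation ω μ eA eC ≫ eB = evansCircuit ω μ eA eB eC := by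
  have h : (eA ⊗ₘ (𝟙 (LB ⊗ MB) ⊗ₘ eC)) ≫ (λ_ ((LB ⊗ MB) ⊗ 𝟙_ C)).hom ≫
      (ρ_ (LB ⊗ MB)).hom ≫ eB =
      (eA ⊗ₘ (eB ⊗ₘ eC)) ≫ (λ_ (𝟙_ C ⊗ 𝟙_ C)).hom ≫ (λ_ (𝟙_ C)).hom := by
    rw [← rightUnitor_naturality, ← leftUnitor_naturality_assoc, ← id_tensorHom,
      ← tensorHom_id, tensorHom_comp_tensorHom_assoc, tensorHom_comp_tensorHom,
      Category.comp_id, Category.comp_id, Category.id_comp, unitors_equal]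
  simp only [evansPreparation, evansCircuit, Category.assoc, h]

/-- If `B` applies a product effect, the Evans circuit falls apart into two closed circuits. -/
theorem evansCircuit_tensor (ω : 𝟙_ C ⟶ LA ⊗ LB) (μ : 𝟙_ C ⟶ MB ⊗ MC)
    (eA : LA ⟶ 𝟙_ C) (d : LB ⟶ 𝟙_ C) (d' : MB ⟶ 𝟙_ C) (eC : MC ⟶ 𝟙_ C) :
    evansCircuit ω μ eA ((d ⊗ₘ d') ≫ (λ_ (𝟙_ C)).hom) eC =
      (ω ≫ (eA ⊗ₘ d) ≫ (λ_ (𝟙_ C)).hom) ≫ (μ ≫ (d' ⊗ₘ eC) ≫ (λ_ (𝟙_ C)).hom) := by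
  have h : (α_ LA LB (MB ⊗ MC)).hom ≫ (𝟙 LA ⊗ₘ (α_ LB MB MC).inv) ≫
      (eA ⊗ₘ (((d ⊗ₘ d') ≫ (λ_ (𝟙_ C)).hom) ⊗ₘ eC)) ≫ (λ_ (𝟙_ C ⊗ 𝟙_ C)).hom ≫ (λ_ (𝟙_ C)).hom =
      (((eA ⊗ₘ d) ≫ (λ_ (𝟙_ C)).hom) ⊗ₘ ((d' ⊗ₘ eC) ≫ (λ_ (𝟙_ C)).hom)) ≫ (λ_ (𝟙_ C)).hom := by
    have e1 : (eA ⊗ₘ (((d ⊗ₘ d') ≫ (λ_ (𝟙_ C)).hom) ⊗ₘ eC)) =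
        (eA ⊗ₘ ((d ⊗ₘ d') ⊗ₘ eC)) ≫ (𝟙_ C ◁ (λ_ (𝟙_ C)).hom ▷ 𝟙_ C) := by
      rw [← id_tensorHom, ← tensorHom_id, tensorHom_comp_tensorHom, tensorHom_comp_tensorHom,
        Category.comp_id, Category.comp_id]
    have e2 : (α_ LA LB (MB ⊗ MC)).hom ≫ (𝟙 LA ⊗ₘ (α_ LB MB MC).inv) ≫
        (eA ⊗ₘ ((d ⊗ₘ d') ⊗ₘ eC)) =
        ((eA ⊗ₘ d) ⊗ₘ (d' ⊗ₘ eC)) ≫ (α_ _ _ _).hom ≫ (𝟙_ C ◁ (α_ _ _ _).inv) := by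
      rw [tensorHom_comp_tensorHom, Category.id_comp, ← associator_inv_naturality,
        associator_naturality_assoc, ← id_tensorHom, tensorHom_comp_tensorHom, Category.comp_id]
    have e3 : (((eA ⊗ₘ d) ≫ (λ_ (𝟙_ C)).hom) ⊗ₘ ((d' ⊗ₘ eC) ≫ (λ_ (𝟙_ C)).hom)) =
        ((eA ⊗ₘ d) ⊗ₘ (d' ⊗ₘ eC)) ≫ ((λ_ (𝟙_ C)).hom ⊗ₘ (λ_ (𝟙_ C)).hom) := by
      rw [tensorHom_comp_tensorHom]
    rw [e1, e3]
    simp only [Category.assoc]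
    rw [reassoc_of% e2]
    -- Only structural isomorphisms differ now, so coherence closes the goal.
    congr 1
    monoidal
  -- Parallel and sequential composition of scalars agree (Eckmann–Hilton); `prob_comp` speaks of
  -- the latter.
  have h' : ∀ f g : 𝟙_ C ⟶ 𝟙_ C, (λ_ (𝟙_ C)).inv ≫ (f ⊗ₘ g) ≫ (λ_ (𝟙_ C)).hom = f ≫ g := by
    intro f g
    rw [MonoidalCategory.tensorHom_def, Category.assoc, leftUnitor_naturality, unitors_equal,
      rightUnitor_naturality_assoc, ← unitors_equal, Iso.inv_hom_id_assoc]
  rw [← h', ← tensorHom_comp_tensorHom, Category.assoc, ← h]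
  rfl

end Circuits

namespace GPT

variable {C : Type u} [Category.{v} C] [MonoidalCategory C] [SymmetricCategory C] (G : GPT C)

theorem isTest_evansPreparation {X Z : Type} [Finite X] [Finite Z] {LA LB MB MC : C}
    {ω : 𝟙_ C ⟶ LA ⊗ LB} {μ : 𝟙_ C ⟶ MB ⊗ MC} {eA : X → (LA ⟶ 𝟙_ C)} {eC : Z → (MC ⟶ 𝟙_ C)}
    (hω : G.IsTest fun _ : Unit => ω) (hμ : G.IsTest fun _ : Unit => μ)
    (hA : G.IsTest eA) (hC : G.IsTest eC) :
    G.IsTest fun z : X × Z => evansPreparation ω μ (eA z.1) (eC z.2) :=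
  G.isTest_unit_comp (G.leftUnitor_inv _) <|
    G.isTest_unit_comp (G.isTest_unit_tensor hω hμ) <|
    G.isTest_unit_comp (G.associator _ _ _) <|
    G.isTest_unit_comp (G.isTest_unit_tensor (G.id _) (G.associator_inv _ _ _)) <|
    G.isTest_comp_unit (G.tensor hA (G.isTest_unit_tensor (G.id _) hC)) <|
    G.isTest_unit_comp (G.leftUnitor _) (G.rightUnitor _)

/-- In an Evans behavior, the probabilities at a fixed outcome of `B` are dominated by a product
of two probability distributions. -/
theorem IsEvansBehavior.exists_le_mul {G : GPT C} {X Y Z : Type} [Fintype X] [Fintype Y]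
    [Fintype Z] {p : X → Y → Z → ℝ} (hp : G.IsEvansBehavior p) (b : Y) :
    ∃ (α : X → ℝ) (γ : Z → ℝ), (∀ a, 0 ≤ α a) ∧ ∑ a, α a = 1 ∧ (∀ c, 0 ≤ γ c) ∧
      ∑ c, γ c = 1 ∧ ∀ a c, 0 ≤ p a b c ∧ p a b c ≤ α a * γ c := by
  obtain ⟨LA, LB, MB, MC, ω, μ, eA, eB, eC, hω, hμ, hA, hB, hC, h⟩ := hp
  obtain ⟨d, hd⟩ := G.exists_discard LB
  obtain ⟨d', hd'⟩ := G.exists_discard MB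
  have hα : G.IsTest fun a => ω ≫ (eA b a ⊗ₘ d) ≫ (λ_ (𝟙_ C)).hom :=
    G.isTest_unit_comp hω (G.isTest_comp_unit (G.isTest_tensor_unit (hA b) hd) (G.leftUnitor _))
  have hγ : G.IsTest fun c => μ ≫ (d' ⊗ₘ eC b c) ≫ (λ_ (𝟙_ C)).hom :=
    G.isTest_unit_comp hμ (G.isTest_comp_unit (G.isTest_unit_tensor hd' (hC b)) (G.leftUnitor _))
  refine ⟨_, _, G.prob_nonneg hα, G.sum_prob hα, G.prob_nonneg hγ, G.sum_prob hγ, fun a c => ?_⟩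
  have hr := G.isTest_evansPreparation hω hμ (hA b) (hC b)
  -- For `b' ≠ b` this circuit does not enter the behavior, but it is still an outcome of a closed
  -- test.
  have hnn : ∀ b', 0 ≤ G.prob (evansCircuit ω μ (eA b a) (eB b') (eC b c)) := fun b' => by
    rw [← evansPreparation_comp]
    exact G.prob_nonneg (G.comp hr hB) ((a, c), b')
  have hsum := G.causality hr hB
    (G.isTest_comp_unit (G.isTest_unit_tensor hd hd') (G.leftUnitor _)) (a, c)
  simp only [evansPreparation_comp, evansCircuit_tensor, G.prob_comp, Finset.univ_unique,
    Finset.sum_singleton] at hsum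
  rw [h]
  exact ⟨hnn b, hsum ▸ Finset.single_le_sum (fun b' _ => hnn b') (Finset.mem_univ b)⟩

end GPT

/-- The witness is at most one as soon as the probabilities at `b = 0` are dominated by a product
of two probability distributions. -/
theorem evansWitness_le_one_of_le_mul {p : Fin 2 → Fin 2 → Fin 2 → ℝ} {α γ : Fin 2 → ℝ}
    (hα : ∀ a, 0 ≤ α a) (hα1 : ∑ a, α a = 1) (hγ : ∀ c, 0 ≤ γ c) (hγ1 : ∑ c, γ c = 1)
    (hp : ∀ a c, 0 ≤ p a 0 c ∧ p a 0 c ≤ α a * γ c) : evansWitness p ≤ 1 := by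
  rw [Fin.sum_univ_two] at hα1 hγ1
  have hmul : ∀ a c a' c', p a 0 c * p a' 0 c' ≤ (α a * γ c) * (α a' * γ c') := fun a c a' c' =>
    mul_le_mul (hp a c).2 (hp a' c').2 (hp a' c').1 (mul_nonneg (hα a) (hγ c))
  have hW : evansWitness p ≤ (α 0 * γ 0) * (α 0 * γ 0) + (α 0 * γ 1) * (α 0 * γ 0) +
      (α 0 * γ 1) * (α 0 * γ 1) + 4 * ((α 1 * γ 1) * (α 0 * γ 0)) +
      (α 1 * γ 0) * (α 1 * γ 0) + (α 1 * γ 1) * (α 1 * γ 0) + (α 1 * γ 1) * (α 1 * γ 1) := by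
    simp only [evansWitness, pow_two]
    linarith [hmul 0 0 0 0, hmul 0 1 0 0, hmul 0 1 0 1, hmul 1 1 0 0, hmul 1 0 1 0,
      hmul 1 1 1 0, hmul 1 1 1 1]
  have hS : 0 ≤ α 0 * α 1 := mul_nonneg (hα 0) (hα 1)
  have hT : 0 ≤ γ 0 * γ 1 := mul_nonneg (hγ 0) (hγ 1)
  have hα' : α 1 = 1 - α 0 := by linarith
  have hγ' : γ 1 = 1 - γ 0 := by linarith
  have hT4 : γ 0 * γ 1 ≤ 1 / 4 := by rw [hγ']; nlinarith [sq_nonneg (γ 0 - 1 / 2)]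
  have hST := mul_nonneg hS (sub_nonneg.2 hT4)
  -- With `S = α 0 * α 1` and `T = γ 0 * γ 1`, the product value is `(1 - 2S)(1 - T) + 4ST`; it
  -- falls short of `1` by `S/2 + T + 6S(1/4 - T) ≥ 0`.
  refine hW.trans (le_of_eq_of_le (b := 1 - 2 * (α 0 * α 1) - γ 0 * γ 1 +
    6 * ((α 0 * α 1) * (γ 0 * γ 1))) ?_ (by linarith))
  rw [hα', hγ']
  ring

theorem evansWitness_le_one {p : Fin 2 → Fin 2 → Fin 2 → ℝ} (hp : p ∈ evansGPTBehaviors.{v, u}) :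
    evansWitness p ≤ 1 := by
  obtain ⟨C, _, _, _, G, h⟩ := hp
  obtain ⟨α, γ, hα, hα1, hγ, hγ1, hle⟩ := h.exists_le_mul 0
  exact evansWitness_le_one_of_le_mul hα hα1 hγ hγ1 hle

theorem evansWitness_pUnfeasible : evansWitness pUnfeasible = 3 / 2 := by
  norm_num [evansWitness, pUnfeasible]

theorem evansWitness_pMixed (t : ℝ) :
    evansWitness (pMixed t) = (25 * t ^ 2 + 18 * t + 5) / 32 := by
  simp only [evansWitness, pMixed, pUnfeasible, pWhite]
  norm_num
  ring

theorem one_lt_evansWitness_pMixed_iff {t : ℝ} (ht : 0 ≤ t) :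
    1 < evansWitness (pMixed t) ↔ (6 * Real.sqrt 21 - 9) / 25 < t := by
  have hs : Real.sqrt 21 ^ 2 = 21 := Real.sq_sqrt (by norm_num)
  -- The two roots of `25t² + 18t - 27`; the second is negative, so its factor is positive for `t ≥
  -- 0`.
  have hfac : evansWitness (pMixed t) - 1 =
      (t - (6 * Real.sqrt 21 - 9) / 25) * (25 / 32 * (t + (6 * Real.sqrt 21 + 9) / 25)) := by
    rw [evansWitness_pMixed]
    linear_combination (9 / 200) * hs
  have hpos : 0 < 25 / 32 * (t + (6 * Real.sqrt 21 + 9) / 25) := by positivity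
  rw [← sub_pos, hfac, mul_pos_iff_of_pos_right hpos, sub_pos]

theorem abs_criticalVisibility_sub_lt :
    |(6 * Real.sqrt 21 - 9) / 25 - 0.7398| < 0.00005 := by
  have h1 : 4.5825 < Real.sqrt 21 := Real.lt_sqrt_of_sq_lt (by norm_num)
  have h2 : Real.sqrt 21 < 4.5826 := (Real.sqrt_lt' (by norm_num)).2 (by norm_num)
  rw [abs_lt]
  constructor <;> linarith

theorem mainTheorem3 :
    (∀ p ∈ evansGPTBehaviors.{v, u}, evansWitness p ≤ 1) ∧
    evansWitness pUnfeasible = 3 / 2 ∧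
    pUnfeasible ∉ evansGPTBehaviors.{v, u} ∧
    (∀ t : ℝ, 0 ≤ t → t ≤ 1 →
      (1 < evansWitness (pMixed t) ↔ (6 * Real.sqrt 21 - 9) / 25 < t)) ∧
    |(6 * Real.sqrt 21 - 9) / 25 - 0.7398| < 0.00005 := by
  refine ⟨fun p hp => evansWitness_le_one hp, evansWitness_pUnfeasible, fun hp => ?_,
    fun t ht _ => one_lt_evansWitness_pMixed_iff ht, abs_criticalVisibility_sub_lt⟩
  have h := evansWitness_le_one hp
  rw [evansWitness_pUnfeasible] at h
  norm_num at h
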